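/- Let $K$ be a number field with $s>0$ real embeddings and $2t>0$ non-real complex embeddings. Let $\sigma_1,\dots,\sigma_s$ be the real embeddings and choose $\sigma_{s+1},\dots,\sigma_{s+t}$, one from each pair of complex conjugate embeddings. Let $U\subset\mathcal O_K^{*}$ be a group of units that are positive under all real embeddings, and assume that $U$ is admissible, i.e. that $\{(\log\sigma_1(u),\dots,\log\sigma_s(u)) : u\in U\}$ is a full lattice (a discrete subgroup spanning $\mathbb R^s$). Let $\mathbb H\subset\mathbb C$ be the upper half-plane. The group $\mathcal O_K\rtimes U$ acts freely and properly discontinuously on $\mathbb H^s\times\mathbb C^t$ by $(a,u)\cdot(z_i)_{i}=(\sigma_i(u)z_i+\sigma_i(a))_{i}$, and the quotient complex manifold $X(K,U)=(\mathbb H^s\times\mathbb C^t)/(\mathcal O_K\rtimes U)$ is called an Oeljeklaus–Toma manifold. On a complex manifold $(M,J)$, a smooth two-form $\omega$ is called an LCK (locally conformally Kähler) form if it is the fundamental form $\omega(\cdot,\cdot)=g(J\cdot,\cdot)$ of a Hermitian metric $g$ and $d\omega=\theta'\wedge\omega$ for some closed one-form $\theta'$. For a closed one-form $\theta$, a form is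 called $d_\theta$-exact if it equals $d_\theta\eta:=d\eta-\theta\wedge\eta$ for some smooth form $\eta$. All forms are smooth and real. **Proposition.** Let $X=X(K,U)$ be an Oeljeklaus–Toma manifold and let $\theta$ be any closed one-form on $X$. Then there is no LCK form on $X$ that is $d_\theta$-exact. -/

import Mathlib

open scoped Manifold ContDiff Topology

noncomputable section

/-! ### Differential forms on manifolds modelled on a normed space -/

section Forms

variable (V : Type*) [NormedAddCommGroup V] [NormedSpace ℝ V]
  (M : Type*) [TopologicalSpace M] [ChartedSpace V M]

/-- A (not necessarily smooth) real differential form of degree `k` on a manifold `M` modelled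
on `V`. -/
abbrev DForm (k : ℕ) : Type _ :=
  ∀ x : M, (TangentSpace 𝓘(ℝ, V) x) [⋀^Fin k]→L[ℝ] ℝ

variable {V M} {k : ℕ}

namespace DForm

/-- The expression of a form in the preferred chart at `x₀`, that is, its pull-back under the
inverse of that chart. It is meaningful on the target of the chart. -/
def inChart (α : DForm V M k) (x₀ : M) : V → V [⋀^Fin k]→L[ℝ] ℝ := fun y =>
  (α ((chartAt V x₀).symm y)).compContinuousLinearMap
    (mfderiv 𝓘(ℝ, V) 𝓘(ℝ, V) (chartAt V x₀).symm y)

/-- A form is smooth if all its expressions in charts are. -/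
def IsSmooth (α : DForm V M k) : Prop :=
  ∀ x₀ : M, ContDiffOn ℝ ∞ (α.inChart x₀) (chartAt V x₀).target

/-- The exterior derivative: at `x`, pull back to `M` the exterior derivative of the expression
of the form in the preferred chart at `x`. -/
def d (α : DForm V M k) : DForm V M (k + 1) := fun x =>
  (extDeriv (α.inChart x) (chartAt V x x)).compContinuousLinearMap
    (mfderiv 𝓘(ℝ, V) 𝓘(ℝ, V) (chartAt V x) x)

/-- The wedge product `θ ∧ α` of a one-form and a `k`-form:
`(θ ∧ α)(v₀, …, v_k) = ∑ i, (-1)^i θ(v_i) α(v₀, …, v̂_i, …, v_k)`. -/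
def wedge (θ : DForm V M 1) (α : DForm V M k) : DForm V M (k + 1) := fun x =>
  ContinuousAlternatingMap.alternatizeUncurryFin (E := V)
    (((ContinuousAlternatingMap.ofSubsingleton ℝ V ℝ (0 : Fin 1)).symm (θ x)).smulRight (α x))

/-- The twisted (Morse–Novikov, Lichnerowicz) differential `d_θ = d - θ ∧ ·`. -/
def dTwisted (θ : DForm V M 1) (α : DForm V M k) : DForm V M (k + 1) :=
  α.d - θ.wedge α

/-- Smooth closed forms. -/
def IsClosedForm (α : DForm V M k) : Prop := α.IsSmooth ∧ α.d = 0

/-- `α = d_θ η` for some smooth form `η`. -/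
def IsTwistedExact (θ : DForm V M 1) (α : DForm V M (k + 1)) : Prop :=
  ∃ η : DForm V M k, η.IsSmooth ∧ α = dTwisted θ η

end DForm

end Forms

/-! ### Hermitian metrics and LCK forms on complex manifolds -/

section LCK

variable {V : Type*} [NormedAddCommGroup V] [NormedSpace ℝ V] [NormedSpace ℂ V]
  {M : Type*} [TopologicalSpace M] [ChartedSpace V M]

/-- The complex structure of a complex manifold: multiplication by `i` on each tangent space,
which is identified with the model space `V` by a holomorphic chart. -/
def tangentJ (x : M) (v : TangentSpace 𝓘(ℝ, V) x) : TangentSpace 𝓘(ℝ, V) x :=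
  (Complex.I • (show V from v) : V)

variable [IsManifold 𝓘(ℝ, V) ∞ M]

/-- The type of smooth Riemannian metrics on `M`. -/
abbrev RiemMetric (V : Type*) [NormedAddCommGroup V] [NormedSpace ℝ V]
    (M : Type*) [TopologicalSpace M] [ChartedSpace V M] [IsManifold 𝓘(ℝ, V) ∞ M] : Type _ :=
  Bundle.ContMDiffRiemannianMetric 𝓘(ℝ, V) ∞ V (fun x : M => TangentSpace 𝓘(ℝ, V) x)

/-- A Riemannian metric is Hermitian if it is `J`-invariant. -/
def RiemMetric.IsHermitian (g : RiemMetric V M) : Prop :=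
  ∀ (x : M) (v w : TangentSpace 𝓘(ℝ, V) x),
    g.inner x (tangentJ x v) (tangentJ x w) = g.inner x v w

/-- `Ω` is the fundamental two-form of `g`: `Ω(v, w) = g(J v, w)`; for a Hermitian metric this
means `g(v, w) = Ω(v, J w)`. -/
def RiemMetric.IsFundamentalForm (g : RiemMetric V M) (Ω : DForm V M 2) : Prop :=
  ∀ (x : M) (v w : TangentSpace 𝓘(ℝ, V) x), Ω x ![v, w] = g.inner x (tangentJ x v) w

/-- A Hermitian metric with fundamental form `Ω` is locally conformally Kähler if
`dΩ = θ ∧ Ω` for some closed one-form `θ`; the form `Ω` is then called an LCK form. -/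
def DForm.IsLCK (Ω : DForm V M 2) : Prop :=
  Ω.IsSmooth ∧
  (∃ g : RiemMetric V M, g.IsHermitian ∧ g.IsFundamentalForm Ω) ∧
  ∃ θ : DForm V M 1, θ.IsClosedForm ∧ Ω.d = θ.wedge Ω

end LCK

/-! ### Oeljeklaus–Toma manifolds -/

open NumberField

/-- The data that define an Oeljeklaus–Toma manifold: a number field `K` with `s > 0` real and
`2t > 0` complex embeddings, one embedding out of each pair of conjugate embeddings, and an
admissible group `U` of totally positive units, that is, one whose logarithmic image in `ℝ ^ s`
is a full lattice. -/
structure OTData (K : Type*) [Field K] [NumberField K] where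
  /-- the embedding chosen for each infinite place -/
  σ : InfinitePlace K → K →+* ℂ
  mk_σ : ∀ w, InfinitePlace.mk (σ w) = w
  real_pos : 0 < InfinitePlace.nrRealPlaces K
  complex_pos : 0 < InfinitePlace.nrComplexPlaces K
  /-- the group of units -/
  U : Subgroup (𝓞 K)ˣ
  totally_positive : ∀ u ∈ U, ∀ w : InfinitePlace K, w.IsReal → 0 < (σ w (u : K)).re
  discrete : DiscreteTopology
    ((fun (u : (𝓞 K)ˣ) (w : {w : InfinitePlace K // w.IsReal}) =>
      Real.log (σ w.1 (u : K)).re) '' (U : Set (𝓞 K)ˣ))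
  span_eq_top : Submodule.span ℝ
    ((fun (u : (𝓞 K)ˣ) (w : {w : InfinitePlace K // w.IsReal}) =>
      Real.log (σ w.1 (u : K)).re) '' (U : Set (𝓞 K)ˣ)) = ⊤

namespace OTData

variable {K : Type*} [Field K] [NumberField K] (D : OTData K)

/-- The open subset `ℍ ^ s × ℂ ^ t` of `ℂ ^ (s + t)`, with coordinates indexed by the infinite
places: the coordinates at the real places lie in the upper half-plane. -/
def domain (_D : OTData K) : TopologicalSpace.Opens (InfinitePlace K → ℂ) where
  carrier := {z | ∀ w : InfinitePlace K, w.IsReal → 0 < (z w).im}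
  is_open' := by
    have : {z : InfinitePlace K → ℂ | ∀ w : InfinitePlace K, w.IsReal → 0 < (z w).im} =
        ⋂ w : InfinitePlace K, ⋂ _ : w.IsReal, {z | 0 < (z w).im} := by
      ext; simp
    rw [this]
    exact isOpen_iInter_of_finite fun w => isOpen_iInter_of_finite fun _ =>
      isOpen_lt continuous_const (Complex.continuous_im.comp (continuous_apply w))

/-- The affine map `z_w ↦ σ_w(u) z_w + σ_w(a)`. -/
def affine (u : (𝓞 K)ˣ) (a : 𝓞 K) (z : InfinitePlace K → ℂ) : InfinitePlace K → ℂ :=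
  fun w => D.σ w (u : K) * z w + D.σ w (a : K)

/-- Two points of `ℍ ^ s × ℂ ^ t` are equivalent if they lie in the same orbit of
`𝓞 K ⋊ U`, where `(a, u)` acts by `z_w ↦ σ_w(u) z_w + σ_w(a)`. -/
def orbitSetoid : Setoid D.domain where
  r z z' := ∃ u ∈ D.U, ∃ a : 𝓞 K, (z' : InfinitePlace K → ℂ) = D.affine u a z
  iseqv := by
    refine ⟨fun z => ⟨1, D.U.one_mem, 0, ?_⟩, ?_, ?_⟩
    · funext w; simp [affine]
    · rintro z z' ⟨u, hu, a, h⟩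
      refine ⟨u⁻¹, D.U.inv_mem hu, -((u⁻¹ : (𝓞 K)ˣ) : 𝓞 K) * a, ?_⟩
      funext w
      have h1 : D.σ w ((u⁻¹ : (𝓞 K)ˣ) : K) * D.σ w (u : K) = 1 := by
        rw [← map_mul]; norm_cast; simp
      simp only [h, affine]
      push_cast
      rw [map_mul, map_neg]
      linear_combination (-(z : InfinitePlace K → ℂ) w) * h1
    · rintro z z' z'' ⟨u, hu, a, h⟩ ⟨v, hv, b, h'⟩
      refine ⟨v * u, D.U.mul_mem hv hu, v * a + b, ?_⟩
      funext w
      simp only [h', h, affine]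
      push_cast
      simp only [map_mul, map_add]
      ring

/-- The Oeljeklaus–Toma manifold `X(K, U) = (ℍ ^ s × ℂ ^ t) / (𝓞 K ⋊ U)`, with the quotient
topology. -/
def Manifold : Type _ := Quotient D.orbitSetoid

instance : TopologicalSpace D.Manifold :=
  inferInstanceAs (TopologicalSpace (Quotient D.orbitSetoid))

/-- The quotient map. -/
def proj : D.domain → D.Manifold := Quotient.mk D.orbitSetoid

lemma proj_eq_iff {z z' : D.domain} : D.proj z = D.proj z' ↔
    ∃ u ∈ D.U, ∃ a : 𝓞 K, (z' : InfinitePlace K → ℂ) = D.affine u a z :=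
  Quotient.eq (r := D.orbitSetoid)

lemma σ_im {w : InfinitePlace K} (hw : w.IsReal) (x : K) : (D.σ w x).im = 0 := by
  have h : ComplexEmbedding.IsReal (D.σ w) := by
    rw [← InfinitePlace.isReal_mk_iff, D.mk_σ]; exact hw
  have := RingHom.congr_fun h x
  rw [ComplexEmbedding.conjugate_coe_eq] at this
  exact Complex.conj_eq_iff_im.mp this

lemma affine_im (u : (𝓞 K)ˣ) (a : 𝓞 K) (z : InfinitePlace K → ℂ) {w : InfinitePlace K}
    (hw : w.IsReal) : (D.affine u a z w).im = (D.σ w (u : K)).re * (z w).im := by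
  simp [affine, D.σ_im hw]

lemma affine_mem {u : (𝓞 K)ˣ} (hu : u ∈ D.U) (a : 𝓞 K) {z : InfinitePlace K → ℂ}
    (hz : z ∈ D.domain) : D.affine u a z ∈ D.domain := fun w hw => by
  rw [D.affine_im u a z hw]
  exact mul_pos (D.totally_positive u hu w hw) (hz w hw)

lemma affine_contDiff {𝕜 : Type*} [NontriviallyNormedField 𝕜] [NormedAlgebra 𝕜 ℂ]
    (n : WithTop ℕ∞) (u : (𝓞 K)ˣ) (a : 𝓞 K) : ContDiff 𝕜 n (D.affine u a) := by
  unfold affine; fun_prop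

lemma continuous_affine (u : (𝓞 K)ˣ) (a : 𝓞 K) : Continuous (D.affine u a) := by
  unfold affine; fun_prop

lemma continuous_proj : Continuous D.proj := continuous_quot_mk

lemma isOpenMap_proj : IsOpenMap D.proj := by
  intro S hS
  refine (isOpen_coinduced (f := D.proj)).mpr ?_
  have : D.proj ⁻¹' (D.proj '' S) = ⋃ u : D.U, ⋃ a : 𝓞 K,
      (fun z : D.domain => (⟨D.affine u.1 a z, D.affine_mem u.2 a z.2⟩ : D.domain)) ⁻¹' S := by
    ext z
    simp only [Set.mem_preimage, Set.mem_image, Set.mem_iUnion]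
    constructor
    · rintro ⟨y, hy, h⟩
      obtain ⟨u, hu, a, h'⟩ := D.proj_eq_iff.mp h.symm
      refine ⟨⟨u, hu⟩, a, ?_⟩
      convert hy
      exact h'.symm
    · rintro ⟨u, a, h⟩
      exact ⟨_, h, (D.proj_eq_iff.mpr ⟨u.1, u.2, a, rfl⟩).symm⟩
  rw [this]
  exact isOpen_iUnion fun u => isOpen_iUnion fun a => hS.preimage
    (((D.continuous_affine u.1 a).comp continuous_subtype_val).subtype_mk _)

lemma norm_σ (w : InfinitePlace K) (x : K) : ‖D.σ w x‖ = w x := by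
  conv_rhs => rw [← D.mk_σ w]
  rfl

/-- The action of `𝓞 K ⋊ U` is free and properly discontinuous, in the form: every point has a
neighbourhood on which the quotient map is injective. -/
lemma exists_injOn (z : D.domain) : ∃ N ∈ 𝓝 z, Set.InjOn D.proj N := by
  classical
  obtain ⟨w₀, hw₀⟩ : ∃ w : InfinitePlace K, w.IsReal := by
    have := D.real_pos
    rw [InfinitePlace.nrRealPlaces, Fintype.card_pos_iff] at this
    exact ⟨this.some.1, this.some.2⟩
  set L : (𝓞 K)ˣ → {w : InfinitePlace K // w.IsReal} → ℝ :=
    fun u w => Real.log (D.σ w.1 (u : K)).re with hL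
  have h0 : (0 : {w : InfinitePlace K // w.IsReal} → ℝ) ∈ L '' (D.U : Set (𝓞 K)ˣ) :=
    ⟨1, D.U.one_mem, by funext w; simp [hL]⟩
  obtain ⟨ε, hε, hball⟩ : ∃ ε > 0, ∀ y ∈ L '' (D.U : Set (𝓞 K)ˣ), dist y 0 < ε → y = 0 := by
    have := D.discrete
    have h := Metric.isOpen_iff.mp
      (isOpen_discrete ({⟨0, h0⟩} : Set (L '' (D.U : Set (𝓞 K)ˣ)))) ⟨0, h0⟩ rfl
    obtain ⟨ε, hε, h⟩ := h
    refine ⟨ε, hε, fun y hy hd => ?_⟩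
    have : (⟨y, hy⟩ : L '' (D.U : Set (𝓞 K)ˣ)) ∈
        ({⟨0, h0⟩} : Set (L '' (D.U : Set (𝓞 K)ˣ))) := h hd
    exact congrArg Subtype.val this
  let ly : D.domain → {w : InfinitePlace K // w.IsReal} → ℝ :=
    fun x w => Real.log ((x : InfinitePlace K → ℂ) w.1).im
  have hly : Continuous ly := by
    refine continuous_pi fun w => Continuous.log ?_ fun x => (x.2 w.1 w.2).ne'
    exact Complex.continuous_im.comp ((continuous_apply w.1).comp continuous_subtype_val)
  refine ⟨ly ⁻¹' Metric.ball (ly z) (ε / 2) ∩ Metric.ball z (1 / 2),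
    Filter.inter_mem (hly.continuousAt.preimage_mem_nhds (Metric.ball_mem_nhds _ (by positivity)))
      (Metric.ball_mem_nhds _ (by norm_num)), ?_⟩
  rintro x ⟨hx, hx'⟩ y ⟨hy, hy'⟩ hxy
  obtain ⟨u, hu, a, h⟩ := D.proj_eq_iff.mp hxy
  have hLu : L u = ly y - ly x := by
    funext w
    have h1 := D.totally_positive u hu w.1 w.2
    have h2 := x.2 w.1 w.2
    simp only [hL, ly, h, Pi.sub_apply]
    rw [D.affine_im u a x w.2, Real.log_mul h1.ne' h2.ne']
    ring
  have hLu0 : L u = 0 := by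
    refine hball _ ⟨u, hu, rfl⟩ ?_
    rw [hLu, dist_zero_right, ← dist_eq_norm]
    have h1 := Metric.mem_ball.mp hx
    have h2 := Metric.mem_ball.mp hy
    have h3 := dist_triangle_right (ly y) (ly x) (ly z)
    linarith
  have hu1 : D.σ w₀ (u : K) = 1 := by
    have h1 := D.totally_positive u hu w₀ hw₀
    have h2 : Real.log (D.σ w₀ (u : K)).re = 0 := congrFun hLu0 ⟨w₀, hw₀⟩
    have h3 : (D.σ w₀ (u : K)).re = 1 := Real.eq_one_of_pos_of_log_eq_zero h1 h2
    exact Complex.ext (by simpa using h3) (by simpa using D.σ_im hw₀ _)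
  have hu1' : (u : K) = 1 := (D.σ w₀).injective (by rw [hu1, map_one])
  have hsmall : ∀ w : InfinitePlace K, w (a : K) < 1 := by
    intro w
    have h1 : D.σ w (a : K) = (y : InfinitePlace K → ℂ) w - (x : InfinitePlace K → ℂ) w := by
      rw [h]; simp [affine, hu1']
    rw [← D.norm_σ, h1, ← dist_eq_norm]
    have h2 : dist y x < 1 := by
      have h3 := dist_triangle_right y x z
      have h4 := Metric.mem_ball.mp hx'
      have h5 := Metric.mem_ball.mp hy'
      linarith
    exact (dist_le_pi_dist (y : InfinitePlace K → ℂ) x w).trans_lt h2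
  have ha : a = 0 := by
    by_contra hne
    exact absurd (InfinitePlace.one_le_of_lt_one (w := w₀) hne fun w _ => hsmall w)
      (not_le.mpr (hsmall w₀))
  apply Subtype.ext
  rw [h]
  funext w
  simp [affine, hu1', ha]

lemma isLocalHomeomorph_proj : IsLocalHomeomorph D.proj := by
  rw [isLocalHomeomorph_iff_isOpenEmbedding_restrict]
  intro z
  obtain ⟨N, hN, hinj⟩ := D.exists_injOn z
  obtain ⟨N', hN', hopen, hz⟩ := mem_nhds_iff.mp hN
  refine ⟨N', hopen.mem_nhds hz, Topology.IsOpenEmbedding.of_continuous_injective_isOpenMap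
    (D.continuous_proj.comp continuous_subtype_val) ?_ (D.isOpenMap_proj.domRestrict hopen)⟩
  exact Set.injOn_iff_injective.mp (hinj.mono hN')

lemma domain_nonempty : Nonempty D.domain :=
  ⟨⟨fun _ => Complex.I, fun w _ => by simp⟩⟩

/-- The chart of the quotient given by a local inverse of the quotient map. -/
def chartOf (e : OpenPartialHomeomorph D.domain D.Manifold) :
    OpenPartialHomeomorph D.Manifold (InfinitePlace K → ℂ) :=
  e.symm.trans (D.domain.openPartialHomeomorphSubtypeCoe D.domain_nonempty)

/-- The manifold structure of the quotient: the charts are the local inverses of the quotient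
map. -/
instance : ChartedSpace (InfinitePlace K → ℂ) D.Manifold where
  atlas := {c | ∃ e : OpenPartialHomeomorph D.domain D.Manifold, ⇑e = D.proj ∧ c = D.chartOf e}
  chartAt x := D.chartOf (D.isLocalHomeomorph_proj (Quotient.out x)).choose
  mem_chart_source x := by
    have h := (D.isLocalHomeomorph_proj (Quotient.out x)).choose_spec
    have h1 : D.proj (Quotient.out x) = x := Quotient.out_eq x
    have h2 := OpenPartialHomeomorph.map_source _ h.1
    rw [← h.2, h1] at h2
    simpa [chartOf] using h2
  chart_mem_atlas x := ⟨_, (D.isLocalHomeomorph_proj (Quotient.out x)).choose_spec.2.symm, rfl⟩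

lemma chartOf_symm_apply {e : OpenPartialHomeomorph D.domain D.Manifold} (he : ⇑e = D.proj)
    (z : D.domain) : (D.chartOf e).symm (z : InfinitePlace K → ℂ) = D.proj z := by
  have h : (D.domain.openPartialHomeomorphSubtypeCoe D.domain_nonempty).symm
      (z : InfinitePlace K → ℂ) = z :=
    (D.domain.openPartialHomeomorphSubtypeCoe D.domain_nonempty).left_inv (x := z) (by simp)
  simp only [chartOf, OpenPartialHomeomorph.coe_trans_symm, OpenPartialHomeomorph.symm_symm,
    Function.comp_apply, h, he]

lemma mem_domain_of_mem_target {e : OpenPartialHomeomorph D.domain D.Manifold}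
    {z : InfinitePlace K → ℂ} (hz : z ∈ (D.chartOf e).target) : z ∈ D.domain := by
  simp only [chartOf, OpenPartialHomeomorph.trans_target] at hz
  simpa using hz.1

/-- The changes of charts are locally given by the affine maps of the group. -/
lemma chartOf_contDiffOn {𝕜 : Type*} [NontriviallyNormedField 𝕜] [NormedAlgebra 𝕜 ℂ]
    (n : WithTop ℕ∞) {e e' : OpenPartialHomeomorph D.domain D.Manifold}
    (he : ⇑e = D.proj) (he' : ⇑e' = D.proj) :
    ContDiffOn 𝕜 n ((D.chartOf e).symm.trans (D.chartOf e'))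
      ((D.chartOf e).symm.trans (D.chartOf e')).source := by
  intro z hz
  rw [OpenPartialHomeomorph.trans_source] at hz
  have hzt : z ∈ (D.chartOf e).target := hz.1
  have hzs : (D.chartOf e).symm z ∈ (D.chartOf e').source := hz.2
  have hzd := D.mem_domain_of_mem_target hzt
  have hs : (D.chartOf e).symm z = D.proj ⟨z, hzd⟩ := D.chartOf_symm_apply he ⟨z, hzd⟩
  set y := D.chartOf e' ((D.chartOf e).symm z) with hy
  have hyt : y ∈ (D.chartOf e').target := (D.chartOf e').map_source hzs
  have hyd := D.mem_domain_of_mem_target hyt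
  have hyz : D.proj ⟨z, hzd⟩ = D.proj ⟨y, hyd⟩ := by
    rw [← hs, ← D.chartOf_symm_apply he' ⟨y, hyd⟩]
    exact ((D.chartOf e').left_inv hzs).symm
  obtain ⟨u, hu, a, h⟩ := D.proj_eq_iff.mp hyz
  have hev : ∀ᶠ x in 𝓝 z, ((D.chartOf e).symm.trans (D.chartOf e')) x = D.affine u a x := by
    have h1 : ∀ᶠ x in 𝓝 z, D.affine u a x ∈ (D.chartOf e').target := by
      refine (D.continuous_affine u a).continuousAt.eventually
        ((D.chartOf e').open_target.mem_nhds ?_)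
      rw [← show y = D.affine u a z from h]; exact hyt
    filter_upwards [h1, D.domain.isOpen.mem_nhds hzd] with x hx hxd
    have h2 : D.proj ⟨x, hxd⟩ = D.proj ⟨D.affine u a x, D.affine_mem hu a hxd⟩ :=
      D.proj_eq_iff.mpr ⟨u, hu, a, rfl⟩
    rw [OpenPartialHomeomorph.coe_trans, Function.comp_apply,
      D.chartOf_symm_apply he ⟨x, hxd⟩, h2, ← D.chartOf_symm_apply he']
    exact (D.chartOf e').right_inv hx
  exact ((D.affine_contDiff n u a).contDiffAt.congr_of_eventuallyEq hev).contDiffWithinAt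

/-- The quotient is a complex manifold. -/
instance : IsManifold 𝓘(ℂ, InfinitePlace K → ℂ) ω D.Manifold := by
  refine isManifold_of_contDiffOn _ _ _ ?_
  rintro _ _ ⟨e, he, rfl⟩ ⟨e', he', rfl⟩
  simpa using D.chartOf_contDiffOn (𝕜 := ℂ) ω he he'

/-- The quotient is a smooth real manifold. -/
instance : IsManifold 𝓘(ℝ, InfinitePlace K → ℂ) ∞ D.Manifold := by
  refine isManifold_of_contDiffOn _ _ _ ?_
  rintro _ _ ⟨e, he, rfl⟩ ⟨e', he', rfl⟩
  simpa using D.chartOf_contDiffOn (𝕜 := ℝ) ∞ he he'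

end OTData

end

/-! Write `Ω = d_θ η` and pull everything back to `ℍ ^ s × ℂ ^ t`. This domain is convex, so there
`θ = df`, and `d(e^{-f} η) = e^{-f} Ω`. The change of `f` under each group element is a constant.

On translations these constants form a homomorphism `𝓞 K → ℝ` invariant under multiplication by `U`.
It kills `(u - 1) 𝓞 K` for some `u ≠ 1` in `U`, an ideal containing a nonzero integer, so it
vanishes (`eq_zero_of_forall_map_mul`). Hence `f`, and with it the coefficients of `e^{-f} η` and
`e^{-f} Ω`, are periodic under `𝓞 K` (`exists_primitive_lift`).

On the slice `Im z_w = 1` at the real places, `𝓞 K` acts cocompactly, so periodic continuous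
functions are bounded (`exists_bound_of_periodic`). The slice contains complex lines in the
direction of a complex place. On such a line `e^{-f} Ω` is at least a positive multiple of the area
form, yet it has a bounded primitive. Stokes on a large square, area against perimeter, gives a
contradiction (`not_le_curl_of_bounded`). -/

noncomputable section

open NumberField


/-! ### Forms and their derivatives in preferred charts -/

section Forms

variable {V : Type*} [NormedAddCommGroup V] [NormedSpace ℝ V]
  {M : Type*} [TopologicalSpace M] [ChartedSpace V M] {k : ℕ}

/-- The value of a form at `x`, as an alternating form on the model space. -/
def DForm.val (α : DForm V M k) (x : M) : V [⋀^Fin k]→L[ℝ] ℝ := α x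

/-- The tangent space at a point is read in the preferred chart of that point, so the derivative of
an inverse chart is that of a transition map. -/
lemma DForm.inChart_apply (α : DForm V M k) (x : M) {z : V} {L : V →L[ℝ] V}
    (hc : ContinuousAt (chartAt V x).symm z)
    (h : HasFDerivAt (chartAt V ((chartAt V x).symm z) ∘ (chartAt V x).symm) L z) :
    α.inChart x z = (α.val ((chartAt V x).symm z)).compContinuousLinearMap L := by
  have h1 : HasMFDerivAt 𝓘(ℝ, V) 𝓘(ℝ, V) (chartAt V x).symm z L := by
    refine ⟨hc, ?_⟩
    simp only [writtenInExtChartAt, extChartAt, mfld_simps]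
    exact h.hasFDerivWithinAt
  rw [DForm.inChart, h1.mfderiv]
  rfl

lemma DForm.val_d (α : DForm V M k) (x : M) :
    α.d.val x = extDeriv (α.inChart x) (chartAt V x x) := by
  have h1 : mfderiv 𝓘(ℝ, V) 𝓘(ℝ, V) (chartAt V x) x = ContinuousLinearMap.id ℝ V := by
    refine HasMFDerivAt.mfderiv ⟨(chartAt V x).continuousAt (mem_chart_source _ _), ?_⟩
    have h : (chartAt V x) ∘ (chartAt V x).symm =ᶠ[𝓝 (chartAt V x x)] id := by
      filter_upwards [(chartAt V x).open_target.mem_nhds (mem_chart_target V x)] with y hy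
      exact (chartAt V x).right_inv hy
    simp only [writtenInExtChartAt, extChartAt, mfld_simps]
    exact ((hasFDerivAt_id (𝕜 := ℝ) _).congr_of_eventuallyEq h).hasFDerivWithinAt
  rw [DForm.val, DForm.d, h1]
  rfl

lemma DForm.val_dTwisted_apply (θ η : DForm V M 1) (x : M) (v w : V) :
    (DForm.dTwisted θ η).val x ![v, w] = η.d.val x ![v, w] -
      (θ.val x ![v] * η.val x ![w] - θ.val x ![w] * η.val x ![v]) := by
  have h1 : (DForm.dTwisted θ η).val x = η.d.val x - (θ.wedge η).val x := rfl
  have h2 : (θ.wedge η).val x = ContinuousAlternatingMap.alternatizeUncurryFin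
    (((ContinuousAlternatingMap.ofSubsingleton ℝ V ℝ (0 : Fin 1)).symm (θ.val x)).smulRight
      (η.val x)) := rfl
  have e1 : (0 : Fin 2).removeNth ![v, w] = ![w] := by ext i; fin_cases i; rfl
  have e2 : (1 : Fin 2).removeNth ![v, w] = ![v] := by ext i; fin_cases i; rfl
  have e3 (y : V) : (fun _ : Fin 1 => y) = ![y] := by ext i; fin_cases i; rfl
  rw [h1, h2]
  simp [ContinuousAlternatingMap.alternatizeUncurryFin_apply, Fin.sum_univ_two, e1, e2, e3]
  ring

end Forms

/-! ### Pull-back of forms to `ℍ ^ s × ℂ ^ t` -/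

namespace OTData

variable {K : Type*} [Field K] [NumberField K] (D : OTData K)

/-- The linear part of the affine map attached to `u`. -/
def scale (u : (𝓞 K)ˣ) : (InfinitePlace K → ℂ) →L[ℝ] (InfinitePlace K → ℂ) :=
  ContinuousLinearMap.pi fun w => D.σ w (u : K) • ContinuousLinearMap.proj (R := ℝ) w

@[simp]
lemma scale_apply (u : (𝓞 K)ˣ) (v : InfinitePlace K → ℂ) (w : InfinitePlace K) :
    D.scale u v w = D.σ w (u : K) * v w := by
  simp [scale]

lemma scale_one : D.scale 1 = ContinuousLinearMap.id ℝ _ := by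
  ext v w; simp

lemma scale_mul (u v : (𝓞 K)ˣ) : D.scale (u * v) = (D.scale u).comp (D.scale v) := by
  ext x w; simp [mul_assoc]

lemma scale_smul (u : (𝓞 K)ˣ) (c : ℂ) (v : InfinitePlace K → ℂ) :
    D.scale u (c • v) = c • D.scale u v := by
  funext w; simp; ring

lemma scale_ne_zero (u : (𝓞 K)ˣ) {v : InfinitePlace K → ℂ} (hv : v ≠ 0) : D.scale u v ≠ 0 := by
  intro h
  apply hv
  have h1 : D.scale (u⁻¹ * u) v = 0 := by rw [scale_mul]; simp [h]
  simpa [scale_one] using h1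

lemma hasFDerivAt_affine (u : (𝓞 K)ˣ) (a : 𝓞 K) (z : InfinitePlace K → ℂ) :
    HasFDerivAt (D.affine u a) (D.scale u) z := by
  have : D.affine u a = fun z => D.scale u z + fun w => D.σ w (a : K) := by
    ext z w; simp [affine]
  rw [this]
  exact (D.scale u).hasFDerivAt.add_const _

lemma fderiv_affine (u : (𝓞 K)ˣ) (a : 𝓞 K) : fderiv ℝ (D.affine u a) = fun _ => D.scale u :=
  funext fun z => (D.hasFDerivAt_affine u a z).fderiv

lemma affine_affine (u v : (𝓞 K)ˣ) (a b : 𝓞 K) (z : InfinitePlace K → ℂ) :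
    D.affine v b (D.affine u a z) = D.affine (v * u) (v * a + b) z := by
  funext w
  simp [affine]
  ring

/-- The local inverses invert the total function `proj`, so the identity holds on the whole domain
and not only on the target of the chart. This is why a single chart expression can serve as the
global pull-back `lift`. -/
lemma chartAt_symm_apply (x : D.Manifold) (z : D.domain) :
    (chartAt (InfinitePlace K → ℂ) x).symm (z : InfinitePlace K → ℂ) = D.proj z :=
  D.chartOf_symm_apply (D.isLocalHomeomorph_proj (Quotient.out x)).choose_spec.2.symm z

lemma mem_domain_of_mem_chartAt_target {x : D.Manifold} {z : InfinitePlace K → ℂ}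
    (hz : z ∈ (chartAt (InfinitePlace K → ℂ) x).target) : z ∈ D.domain :=
  D.mem_domain_of_mem_target hz

/-- In the preferred chart at its image, the quotient map is given near `z` by an affine map of
the group. -/
lemma exists_chartAt_eventuallyEq (z : D.domain) : ∃ u ∈ D.U, ∃ a : 𝓞 K,
    D.affine u a z = chartAt (InfinitePlace K → ℂ) (D.proj z) (D.proj z) ∧
    ∀ x : D.Manifold, (chartAt (InfinitePlace K → ℂ) (D.proj z)) ∘
      (chartAt (InfinitePlace K → ℂ) x).symm =ᶠ[𝓝 (z : InfinitePlace K → ℂ)] D.affine u a := by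
  set c := chartAt (InfinitePlace K → ℂ) (D.proj z) with hc
  have hyt : c (D.proj z) ∈ c.target := c.map_source (mem_chart_source _ _)
  have hyd := D.mem_domain_of_mem_chartAt_target hyt
  have hyz : D.proj z = D.proj ⟨c (D.proj z), hyd⟩ := by
    rw [← D.chartAt_symm_apply (D.proj z) ⟨c (D.proj z), hyd⟩]
    exact (c.left_inv (mem_chart_source _ _)).symm
  obtain ⟨u, hu, a, h⟩ := D.proj_eq_iff.mp hyz
  refine ⟨u, hu, a, h.symm, fun x => ?_⟩
  have h1 : ∀ᶠ y in 𝓝 (z : InfinitePlace K → ℂ), D.affine u a y ∈ c.target := by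
    refine (D.continuous_affine u a).continuousAt.eventually (c.open_target.mem_nhds ?_)
    rw [← h]; exact hyt
  filter_upwards [h1, D.domain.isOpen.mem_nhds z.2] with y hy hyd
  have h2 : D.proj ⟨y, hyd⟩ = D.proj ⟨D.affine u a y, D.affine_mem hu a hyd⟩ :=
    D.proj_eq_iff.mpr ⟨u, hu, a, rfl⟩
  rw [Function.comp_apply, D.chartAt_symm_apply x ⟨y, hyd⟩, h2,
    ← D.chartAt_symm_apply (D.proj z)]
  exact c.right_inv hy

lemma continuousAt_chartAt_symm (x : D.Manifold) (z : D.domain) :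
    ContinuousAt (chartAt (InfinitePlace K → ℂ) x).symm (z : InfinitePlace K → ℂ) := by
  have h : ContinuousOn (chartAt (InfinitePlace K → ℂ) x).symm D.domain := by
    rw [continuousOn_iff_continuous_domRestrict]
    exact D.continuous_proj.congr fun y => (D.chartAt_symm_apply x y).symm
  exact h.continuousAt (D.domain.isOpen.mem_nhds z.2)

variable {k : ℕ}

/-- The pull-back of a form under the quotient map, meaningful on `ℍ ^ s × ℂ ^ t`. -/
def lift (α : DForm (InfinitePlace K → ℂ) D.Manifold k) :
    (InfinitePlace K → ℂ) → (InfinitePlace K → ℂ) [⋀^Fin k]→L[ℝ] ℝ :=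
  α.inChart (D.proj D.domain_nonempty.some)

lemma inChart_apply (α : DForm (InfinitePlace K → ℂ) D.Manifold k) (x : D.Manifold)
    (z : D.domain) {u : (𝓞 K)ˣ} {a : 𝓞 K}
    (h : (chartAt (InfinitePlace K → ℂ) (D.proj z)) ∘
      (chartAt (InfinitePlace K → ℂ) x).symm =ᶠ[𝓝 (z : InfinitePlace K → ℂ)] D.affine u a) :
    α.inChart x z = (α.val (D.proj z)).compContinuousLinearMap (D.scale u) := by
  rw [← D.chartAt_symm_apply x z] at h ⊢
  exact α.inChart_apply x (D.continuousAt_chartAt_symm x z)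
    ((D.hasFDerivAt_affine u a z).congr_of_eventuallyEq h)

lemma inChart_eq_lift (α : DForm (InfinitePlace K → ℂ) D.Manifold k) (x : D.Manifold)
    {z : InfinitePlace K → ℂ} (hz : z ∈ D.domain) : α.inChart x z = D.lift α z := by
  obtain ⟨u, hu, a, -, h⟩ := D.exists_chartAt_eventuallyEq ⟨z, hz⟩
  rw [lift, D.inChart_apply α _ ⟨z, hz⟩ (h _), D.inChart_apply α _ ⟨z, hz⟩ (h _)]

/-- The same `u` serves forms of all degrees, so pointwise identities on the quotient transfer to
the pull-backs. -/
lemma exists_lift_eq (z : D.domain) : ∃ u ∈ D.U, ∃ a : 𝓞 K,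
    D.affine u a z = chartAt (InfinitePlace K → ℂ) (D.proj z) (D.proj z) ∧
    ∀ {k : ℕ} (α : DForm (InfinitePlace K → ℂ) D.Manifold k),
      D.lift α z = (α.val (D.proj z)).compContinuousLinearMap (D.scale u) := by
  obtain ⟨u, hu, a, h1, h⟩ := D.exists_chartAt_eventuallyEq z
  exact ⟨u, hu, a, h1, fun α => D.inChart_apply α _ z (h _)⟩

/-- Invariance under the group: both sides come from the value of `α` at one point of the quotient,
and the linear parts compose by the chain rule. -/
lemma affine_lift_eq (α : DForm (InfinitePlace K → ℂ) D.Manifold k) {u : (𝓞 K)ˣ}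
    (hu : u ∈ D.U) (a : 𝓞 K) {z : InfinitePlace K → ℂ} (hz : z ∈ D.domain) :
    (D.lift α (D.affine u a z)).compContinuousLinearMap (D.scale u) = D.lift α z := by
  have hp : D.proj ⟨z, hz⟩ = D.proj ⟨D.affine u a z, D.affine_mem hu a hz⟩ :=
    D.proj_eq_iff.mpr ⟨u, hu, a, rfl⟩
  obtain ⟨v, hv, b, h1, h⟩ := D.exists_chartAt_eventuallyEq ⟨_, D.affine_mem hu a hz⟩
  rw [lift, D.inChart_apply α _ ⟨_, D.affine_mem hu a hz⟩ (h _), ← hp,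
    D.inChart_apply (u := v * u) (a := v * a + b) α _ ⟨z, hz⟩, scale_mul]
  · rfl
  · have h2 := (h (D.proj D.domain_nonempty.some)).comp_tendsto
      (D.continuous_affine u a).continuousAt
    filter_upwards [h2, D.domain.isOpen.mem_nhds hz] with y hy hyd
    rw [← D.affine_affine, ← Function.comp_apply (f := D.affine v b), ← hy, hp]
    simp only [Function.comp_apply]
    rw [D.chartAt_symm_apply _ ⟨y, hyd⟩, D.chartAt_symm_apply _ ⟨_, D.affine_mem hu a hyd⟩,
      show D.proj ⟨y, hyd⟩ = D.proj ⟨_, D.affine_mem hu a hyd⟩ from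
        D.proj_eq_iff.mpr ⟨u, hu, a, rfl⟩]

lemma lift_add_translation (α : DForm (InfinitePlace K → ℂ) D.Manifold k) (a : 𝓞 K)
    {z : InfinitePlace K → ℂ} (hz : z ∈ D.domain) :
    D.lift α (D.affine 1 a z) = D.lift α z := by
  rw [← D.affine_lift_eq α D.U.one_mem a hz, scale_one]
  rfl

/-- Smoothness is given only on targets of preferred charts. Some group element moves `z` into the
target of the chart at its image, and invariance carries smoothness back. -/
lemma contDiffOn_lift {α : DForm (InfinitePlace K → ℂ) D.Manifold k} (hα : α.IsSmooth) :
    ContDiffOn ℝ ∞ (D.lift α) D.domain := by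
  intro z hz
  obtain ⟨u, hu, a, h1, -⟩ := D.exists_chartAt_eventuallyEq ⟨z, hz⟩
  set c := chartAt (InfinitePlace K → ℂ) (D.proj ⟨z, hz⟩)
  have hc : c (D.proj ⟨z, hz⟩) ∈ c.target := mem_chart_target _ _
  have h2 : ContDiffAt ℝ ∞ (D.lift α) (D.affine u a z) := by
    rw [h1]
    refine ((hα (D.proj ⟨z, hz⟩)).contDiffAt (c.open_target.mem_nhds hc)).congr_of_eventuallyEq ?_
    filter_upwards [c.open_target.mem_nhds hc] with y hy
    exact (D.inChart_eq_lift α _ (D.mem_domain_of_mem_chartAt_target hy)).symm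
  have h3 : ContDiffAt ℝ ∞ (fun y => (D.lift α (D.affine u a y)).compContinuousLinearMap
      (D.scale u)) z :=
    (ContinuousAlternatingMap.compContinuousLinearMapCLM (ι := Fin k) (F := ℝ)
      (D.scale u)).contDiff.contDiffAt.comp z
      (h2.comp z (D.affine_contDiff ∞ u a).contDiffAt)
  refine (h3.congr_of_eventuallyEq ?_).contDiffWithinAt
  filter_upwards [D.domain.isOpen.mem_nhds hz] with y hy
  exact (D.affine_lift_eq α hu a hy).symm

lemma differentiableAt_lift {α : DForm (InfinitePlace K → ℂ) D.Manifold k} (hα : α.IsSmooth)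
    {z : InfinitePlace K → ℂ} (hz : z ∈ D.domain) : DifferentiableAt ℝ (D.lift α) z :=
  ((D.contDiffOn_lift hα).contDiffAt (D.domain.isOpen.mem_nhds hz)).differentiableAt (by simp)

/-- Same transport as for smoothness, now with naturality of the exterior derivative under the
affine map. -/
lemma lift_d {α : DForm (InfinitePlace K → ℂ) D.Manifold k} (hα : α.IsSmooth)
    {z : InfinitePlace K → ℂ} (hz : z ∈ D.domain) : D.lift α.d z = extDeriv (D.lift α) z := by
  obtain ⟨u, hu, a, h1, h⟩ := D.exists_lift_eq ⟨z, hz⟩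
  have hd := D.affine_mem hu a hz
  have e1 : α.inChart (D.proj ⟨z, hz⟩) =ᶠ[𝓝 (D.affine u a z)] D.lift α := by
    filter_upwards [D.domain.isOpen.mem_nhds hd] with y hy using D.inChart_eq_lift α _ hy
  have e2 : D.lift α =ᶠ[𝓝 z] fun y => (D.lift α (D.affine u a y)).compContinuousLinearMap
      (fderiv ℝ (D.affine u a) y) := by
    filter_upwards [D.domain.isOpen.mem_nhds hz] with y hy
    rw [fderiv_affine]
    exact (D.affine_lift_eq α hu a hy).symm
  rw [h, DForm.val_d, ← h1, e1.extDeriv_eq, e2.extDeriv_eq,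
    extDeriv_pullback (r := 2) (D.differentiableAt_lift hα hd)
      (D.affine_contDiff 2 u a).contDiffAt (by simp), fderiv_affine]

lemma lift_dTwisted_apply (θ : DForm (InfinitePlace K → ℂ) D.Manifold 1)
    {η : DForm (InfinitePlace K → ℂ) D.Manifold 1} (hη : η.IsSmooth)
    {z : InfinitePlace K → ℂ} (hz : z ∈ D.domain) (v w : InfinitePlace K → ℂ) :
    D.lift (DForm.dTwisted θ η) z ![v, w] = extDeriv (D.lift η) z ![v, w] -
      (D.lift θ z ![v] * D.lift η z ![w] - D.lift θ z ![w] * D.lift η z ![v]) := by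
  obtain ⟨u, hu, a, h1, h⟩ := D.exists_lift_eq ⟨z, hz⟩
  have e1 (x : InfinitePlace K → ℂ) : D.scale u ∘ ![x] = ![D.scale u x] := by
    ext i; fin_cases i; rfl
  have e2 (x y : InfinitePlace K → ℂ) : D.scale u ∘ ![x, y] = ![D.scale u x, D.scale u y] := by
    ext i; fin_cases i <;> rfl
  rw [← D.lift_d hη hz, h, h, h, h]
  simp only [ContinuousAlternatingMap.compContinuousLinearMap_apply, e1, e2]
  exact DForm.val_dTwisted_apply θ η _ _ _

/-- `Ω(v, Jv) = g(Jv, Jv) = g(v, v)`, and the linear parts of the group commute with multiplication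
by `i`. -/
lemma lift_pos {Ω : DForm (InfinitePlace K → ℂ) D.Manifold 2}
    {g : RiemMetric (InfinitePlace K → ℂ) D.Manifold} (hg : g.IsHermitian)
    (hΩ : g.IsFundamentalForm Ω) {z : InfinitePlace K → ℂ} (hz : z ∈ D.domain)
    {v : InfinitePlace K → ℂ} (hv : v ≠ 0) : 0 < D.lift Ω z ![v, Complex.I • v] := by
  obtain ⟨u, hu, a, h1, h⟩ := D.exists_lift_eq ⟨z, hz⟩
  have e2 (x y : InfinitePlace K → ℂ) : D.scale u ∘ ![x, y] = ![D.scale u x, D.scale u y] := by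
    ext i; fin_cases i <;> rfl
  rw [h, ContinuousAlternatingMap.compContinuousLinearMap_apply, e2, scale_smul]
  have h2 := hΩ (D.proj ⟨z, hz⟩) (D.scale u v) (tangentJ (D.proj ⟨z, hz⟩) (D.scale u v))
  have h3 := hg (D.proj ⟨z, hz⟩) (D.scale u v) (D.scale u v)
  have h4 := g.pos (D.proj ⟨z, hz⟩) (D.scale u v) (D.scale_ne_zero u hv)
  rw [← h3, ← h2] at h4
  exact h4

end OTData


/-! ### Stokes on large squares and the Poincaré lemma for one-forms -/

open MeasureTheory in
/-- Bounded functions `g`, `h` on the plane cannot have `∂g/∂p - ∂h/∂q` bounded below by a positive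
constant. -/
lemma not_le_curl_of_bounded {g h : ℝ × ℝ → ℝ} (hg : ContDiff ℝ 1 g) (hh : ContDiff ℝ 1 h)
    {B ε : ℝ} (hgB : ∀ p, |g p| ≤ B) (hhB : ∀ p, |h p| ≤ B) (hε : 0 < ε)
    (hc : ∀ p, ε ≤ fderiv ℝ g p (1, 0) - fderiv ℝ h p (0, 1)) : False := by
  have hcont : Continuous fun p : ℝ × ℝ => fderiv ℝ g p (1, 0) + (-fderiv ℝ h p) (0, 1) :=
    ((hg.continuous_fderiv one_ne_zero).clm_apply continuous_const).add
      ((hh.continuous_fderiv one_ne_zero).neg.clm_apply continuous_const)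
  have hB : 0 ≤ B := (abs_nonneg _).trans (hgB 0)
  -- On the square of side `R` the integral is at least `ε R²` and the boundary terms at most `4 B
  -- R`; this `R` makes `ε R = 4 B + ε`.
  obtain ⟨R, hR⟩ : ∃ R : ℝ, R = 4 * B / ε + 1 := ⟨_, rfl⟩
  have hR0 : 0 < R := by rw [hR]; positivity
  have key := integral2_divergence_prod_of_hasFDerivAt g (-h) (fun p => fderiv ℝ g p)
    (fun p => -fderiv ℝ h p) 0 0 R R hg.continuous.continuousOn hh.continuous.neg.continuousOn
    (fun x _ => (hg.differentiable one_ne_zero x).hasFDerivAt)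
    (fun x _ => (hh.differentiable one_ne_zero x).hasFDerivAt.neg)
    (hcont.continuousOn.integrableOn_compact (isCompact_uIcc.prod isCompact_uIcc))
  have hlow : ε * R * R ≤ ∫ x in (0 : ℝ)..R, ∫ y in (0 : ℝ)..R,
      fderiv ℝ g (x, y) (1, 0) + (-fderiv ℝ h (x, y)) (0, 1) := by
    have h1 : ∀ x : ℝ, ε * R ≤ ∫ y in (0 : ℝ)..R,
        fderiv ℝ g (x, y) (1, 0) + (-fderiv ℝ h (x, y)) (0, 1) := by
      intro x
      have := intervalIntegral.integral_mono_on (μ := volume) (f := fun _ => ε) hR0.le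
        intervalIntegrable_const
        ((hcont.comp (by fun_prop : Continuous fun y : ℝ => (x, y))).intervalIntegrable 0 R)
        (fun y _ => by simpa [sub_eq_add_neg] using hc (x, y))
      simpa [mul_comm] using this
    have := intervalIntegral.integral_mono_on (μ := volume) (f := fun _ => ε * R) hR0.le
      intervalIntegrable_const
      ((intervalIntegral.continuous_parametric_intervalIntegral_of_continuous'
        (f := fun x y => fderiv ℝ g (x, y) (1, 0) + (-fderiv ℝ h (x, y)) (0, 1))
        (by simpa [Function.uncurry_def] using hcont) 0 R).intervalIntegrable 0 R)
      (fun x _ => h1 x)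
    simpa [mul_comm, mul_assoc, mul_left_comm] using this
  have hup : ∀ φ : ℝ → ℝ, (∀ x, |φ x| ≤ B) → |∫ x in (0 : ℝ)..R, φ x| ≤ B * R := fun φ hφ => by
    simpa [abs_of_pos hR0] using
      intervalIntegral.norm_integral_le_of_norm_le_const (a := 0) (b := R) (f := φ) fun x _ => hφ x
  have b1 := abs_le.mp (hup (fun x => (-h) (x, R)) fun x => by simpa using hhB (x, R))
  have b2 := abs_le.mp (hup (fun x => (-h) (x, 0)) fun x => by simpa using hhB (x, 0))
  have b3 := abs_le.mp (hup (fun y => g (R, y)) fun y => hgB (R, y))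
  have b4 := abs_le.mp (hup (fun y => g (0, y)) fun y => hgB (0, y))
  have h2 : ε * R * R ≤ 4 * B * R := by linarith [b1.2, b2.1, b3.2, b4.1]
  have h3 : ε * R ≤ 4 * B := le_of_mul_le_mul_right h2 hR0
  have h4 : ε * R = 4 * B + ε := by rw [hR]; field_simp
  linarith

lemma extDeriv_one_form_apply {E : Type*} [NormedAddCommGroup E] [NormedSpace ℝ E]
    {α : E → E [⋀^Fin 1]→L[ℝ] ℝ} {z : E} (hα : DifferentiableAt ℝ α z) (v w : E) :
    extDeriv α z ![v, w] = fderiv ℝ (fun y => α y ![w]) z v - fderiv ℝ (fun y => α y ![v]) z w := by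
  have e1 : (0 : Fin 2).removeNth ![v, w] = ![w] := by ext i; fin_cases i; rfl
  have e2 : (1 : Fin 2).removeNth ![v, w] = ![v] := by ext i; fin_cases i; rfl
  rw [extDeriv_apply hα, Fin.sum_univ_two, e1, e2]
  simp [sub_eq_add_neg]

/-- A closed one-form on an open convex set is the derivative of a function. -/
lemma exists_hasFDerivAt_of_extDeriv_eq_zero {E : Type*} [NormedAddCommGroup E] [NormedSpace ℝ E]
    {α : E → E [⋀^Fin 1]→L[ℝ] ℝ} {s : Set E} (hs : Convex ℝ s) (hso : IsOpen s)
    (hα : DifferentiableOn ℝ α s) (hd : ∀ z ∈ s, extDeriv α z = 0) :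
    ∃ f : E → ℝ, ContDiffOn ℝ 1 f s ∧ ∀ z ∈ s, ∀ v, fderiv ℝ f z v = α z ![v] := by
  let T := (ContinuousAlternatingMap.ofSubsingletonLIE (𝕜 := ℝ) (E := E) (F := ℝ) (0 : Fin 1)).symm
  have hT : ∀ z v, T (α z) v = α z ![v] := fun z v => by
    have e3 : (fun _ : Fin 1 => v) = ![v] := by ext i; fin_cases i; rfl
    rw [← e3]; rfl
  have hTd : DifferentiableOn ℝ (fun z => T (α z)) s := fun z hz =>
    T.differentiable.differentiableAt.comp_differentiableWithinAt z (hα z hz)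
  obtain ⟨f, hf⟩ : ∃ f : E → ℝ, ∀ z ∈ s, HasFDerivAt f (T (α z)) z :=
    hs.exists_forall_hasFDerivAt_of_fderiv_symmetric hso hTd fun z hz v w => by
      have hαz := hα.differentiableAt (hso.mem_nhds hz)
      have hTz := hTd.differentiableAt (hso.mem_nhds hz)
      have h1 := extDeriv_one_form_apply hαz v w
      have h2 : ∀ x y, fderiv ℝ (fun z => T (α z)) z x y = fderiv ℝ (fun z => α z ![y]) z x := by
        intro x y
        simp_rw [← hT]
        rw [fderiv_clm_apply hTz (by fun_prop)]
        simp
      rw [h2, h2, ← sub_eq_zero, ← h1, hd z hz]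
      rfl
  refine ⟨f, ?_, fun z hz v => by rw [(hf z hz).fderiv, hT]⟩
  rw [← zero_add 1, contDiffOn_succ_iff_fderiv_of_isOpen hso]
  refine ⟨fun z hz => (hf z hz).differentiableAt.differentiableWithinAt, by simp, ?_⟩
  exact contDiffOn_zero.mpr (hTd.continuousOn.congr fun z hz => (hf z hz).fderiv)

/-! ### The lattice `𝓞 K`: cocompactness and `U`-invariant homomorphisms -/

namespace OTData

variable {K : Type*} [Field K] [NumberField K] (D : OTData K)

lemma convex_domain : Convex ℝ (D.domain : Set (InfinitePlace K → ℂ)) := by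
  intro x hx y hy a b ha hb hab w hw
  have h1 := hx w hw
  have h2 := hy w hw
  simp only [Pi.add_apply, Pi.smul_apply, Complex.add_im, Complex.smul_im, smul_eq_mul]
  rcases ha.eq_or_lt with rfl | ha'
  · obtain rfl : b = 1 := by linarith
    simpa using h2
  · have := mul_pos ha' h1
    have := mul_nonneg hb h2.le
    linarith

/-- The image of `𝓞 K` is cocompact in `ℝ ^ s × ℂ ^ t`. -/
lemma exists_norm_sub_le : ∃ R : ℝ, ∀ x : InfinitePlace K → ℂ,
    (∀ w : InfinitePlace K, w.IsReal → (x w).im = 0) →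
    ∃ a : 𝓞 K, ∀ w, ‖x w - D.σ w (a : K)‖ ≤ R := by
  classical
  let b := mixedEmbedding.latticeBasis K
  refine ⟨∑ i, ‖b i‖, fun x hx => ?_⟩
  -- The mixed space uses `w.embedding`, which may be the conjugate of the chosen `σ w`; conjugating
  -- the coordinate then leaves norms unchanged.
  let m : mixedEmbedding.mixedSpace K :=
    (fun w => (x w.1).re, fun w => if D.σ w.1 = w.1.embedding then x w.1 else
      (starRingEnd ℂ) (x w.1))
  have h1 := ZSpan.norm_fract_le (K := ℝ) b m
  obtain ⟨a, ha⟩ := (mixedEmbedding.mem_span_latticeBasis K).mp (ZSpan.floor b m).2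
  refine ⟨a, fun w => le_trans ?_ h1⟩
  have ha' : mixedEmbedding K (a : K) = (ZSpan.floor b m : mixedEmbedding.mixedSpace K) := ha
  rw [ZSpan.fract_apply, ← ha']
  have hσ : D.σ w = w.embedding ∨ ComplexEmbedding.conjugate (D.σ w) = w.embedding := by
    have := InfinitePlace.embedding_mk_eq (D.σ w)
    rw [D.mk_σ w] at this
    rcases this with h | h
    · exact Or.inl h.symm
    · exact Or.inr h.symm
  by_cases hw : w.IsReal
  · refine le_trans ?_ ((norm_le_pi_norm _ ⟨w, hw⟩).trans (norm_fst_le _))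
    have hr : w.embedding (a : K) = D.σ w (a : K) := by
      rcases hσ with h | h
      · rw [h]
      · rw [← h, ComplexEmbedding.conjugate_coe_eq]
        exact Complex.conj_eq_iff_im.mpr (D.σ_im hw _)
    rw [← Complex.norm_real]
    refine le_of_eq (congrArg norm ?_)
    have e1 : ((x w).re : ℂ) = x w := Complex.ext (by simp) (by simp [hx w hw])
    simp [m, e1, InfinitePlace.embedding_of_isReal_apply, hr]
  · have hw' : w.IsComplex := InfinitePlace.not_isReal_iff_isComplex.mp hw
    refine le_trans ?_ ((norm_le_pi_norm _ ⟨w, hw'⟩).trans (norm_snd_le _))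
    by_cases h : D.σ w = w.embedding
    · simp [m, h]
    · have h' := hσ.resolve_left h
      have e : w.embedding (a : K) = (starRingEnd ℂ) (D.σ w (a : K)) := by
        rw [← h', ComplexEmbedding.conjugate_coe_eq]
      simp only [m, Prod.snd_sub, Pi.sub_apply, if_neg h,
        mixedEmbedding.mixedEmbedding_apply_isComplex, e, ← map_sub, RCLike.norm_conj]
      exact le_rfl

/-- A continuous function which is periodic under `𝓞 K` is bounded on the slice where the
imaginary parts of the coordinates at the real places are `1`. -/
lemma exists_bound_of_periodic {Φ : (InfinitePlace K → ℂ) → ℝ} (hΦ : ContinuousOn Φ D.domain)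
    (hper : ∀ (a : 𝓞 K), ∀ z ∈ D.domain, Φ (D.affine 1 a z) = Φ z) :
    ∃ B : ℝ, ∀ z : InfinitePlace K → ℂ, (∀ w : InfinitePlace K, w.IsReal → (z w).im = 1) →
      |Φ z| ≤ B := by
  obtain ⟨R, hR⟩ := D.exists_norm_sub_le
  let S : Set (InfinitePlace K → ℂ) := {z | ∀ w : InfinitePlace K, w.IsReal → (z w).im = 1}
  have hSd : S ⊆ D.domain := fun z hz w hw => by rw [hz w hw]; exact one_pos
  have hS : IsClosed S := by
    have : S = ⋂ w : InfinitePlace K, ⋂ _ : w.IsReal, {z | (z w).im = 1} := by ext; simp [S]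
    rw [this]
    exact isClosed_iInter fun w => isClosed_iInter fun _ =>
      isClosed_eq (Complex.continuous_im.comp (continuous_apply w)) continuous_const
  let z₀ : InfinitePlace K → ℂ := fun _ => Complex.I
  have hC : IsCompact (S ∩ Metric.closedBall z₀ (max R 0)) :=
    (isCompact_closedBall _ _).inter_left hS
  obtain ⟨B, hB⟩ := hC.exists_bound_of_continuousOn
    (hΦ.mono (Set.inter_subset_left.trans hSd))
  refine ⟨B, fun z hz => ?_⟩
  -- Both points lie on the slice, so the difference is real at the real places, as cocompactness
  -- requires.
  obtain ⟨a, ha⟩ := hR (z - z₀) fun w hw => by simp [z₀, hz w hw]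
  have h1 : D.affine 1 (-a) z ∈ S := fun w hw => by rw [D.affine_im _ _ _ hw]; simp [hz w hw]
  rw [← hper (-a) z (hSd hz)]
  refine hB _ ⟨h1, ?_⟩
  rw [Metric.mem_closedBall, dist_pi_le_iff (le_max_right _ _)]
  intro w
  refine le_trans (le_of_eq ?_) ((ha w).trans (le_max_left _ _))
  rw [dist_eq_norm]
  congr 1
  simp [affine]
  ring

/-- The logarithmic image of a trivial group spans only `0`, whereas `s > 0`. -/
lemma exists_mem_U_ne_one : ∃ u ∈ D.U, u ≠ 1 := by
  classical
  by_contra! h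
  have hne : Nonempty {w : InfinitePlace K // w.IsReal} := Fintype.card_pos_iff.mp D.real_pos
  have h1 := D.span_eq_top
  have h2 : Submodule.span ℝ ((fun (u : (𝓞 K)ˣ) (w : {w : InfinitePlace K // w.IsReal}) =>
      Real.log (D.σ w.1 (u : K)).re) '' (D.U : Set (𝓞 K)ˣ)) = ⊥ := by
    rw [Submodule.span_eq_bot]
    rintro _ ⟨u, hu, rfl⟩
    obtain rfl := h u hu
    funext w
    simp
  rw [h2] at h1
  exact bot_ne_top h1

/-- A homomorphism from `𝓞 K` to `ℝ` that is invariant under `U` vanishes. -/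
lemma eq_zero_of_forall_map_mul (c : 𝓞 K →+ ℝ) (hc : ∀ u ∈ D.U, ∀ a, c (u * a) = c a) :
    c = 0 := by
  obtain ⟨u, hu, hu1⟩ := D.exists_mem_U_ne_one
  have hx : (u : 𝓞 K) - 1 ≠ 0 := fun h => hu1 (Units.ext (sub_eq_zero.mp h))
  -- The norm of the ideal `(u - 1)` is a nonzero integer lying in that ideal.
  obtain ⟨y, n, hn, hy⟩ : ∃ (y : 𝓞 K) (n : ℤ), n ≠ 0 ∧ ((u : 𝓞 K) - 1) * y = n := by
    obtain ⟨y, hy⟩ := Ideal.mem_span_singleton.mp (Ideal.absNorm_mem (Ideal.span {(u : 𝓞 K) - 1}))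
    exact ⟨y, (Ideal.absNorm (Ideal.span {(u : 𝓞 K) - 1}) : ℕ),
      by simpa [Ideal.absNorm_eq_zero_iff] using hx, by rw [← hy]; simp⟩
  ext a
  have h1 : c (((u : 𝓞 K) - 1) * y * a) = 0 := by
    rw [mul_assoc, sub_mul, one_mul, map_sub, hc u hu, sub_self]
  rw [hy, ← zsmul_eq_mul, map_zsmul] at h1
  simpa [hn] using h1

end OTData


/-! ### The periodic primitive of `θ` and the contradiction -/

namespace OTData

variable {K : Type*} [Field K] [NumberField K] (D : OTData K)

/-- The pull-back of a closed one-form has a primitive, and it is invariant under `𝓞 K`. -/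
lemma exists_primitive_lift {θ : DForm (InfinitePlace K → ℂ) D.Manifold 1}
    (hθ : θ.IsClosedForm) : ∃ f : (InfinitePlace K → ℂ) → ℝ, ContDiffOn ℝ 1 f D.domain ∧
      (∀ z ∈ D.domain, ∀ v, fderiv ℝ f z v = D.lift θ z ![v]) ∧
      ∀ (a : 𝓞 K), ∀ z ∈ D.domain, f (D.affine 1 a z) = f z := by
  have hclosed : ∀ z ∈ D.domain, extDeriv (D.lift θ) z = 0 := fun z hz => by
    obtain ⟨u, hu, a, -, h⟩ := D.exists_lift_eq ⟨z, hz⟩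
    rw [← D.lift_d hθ.1 hz, hθ.2, h]
    rfl
  obtain ⟨f, hf1, hf⟩ := exists_hasFDerivAt_of_extDeriv_eq_zero D.convex_domain D.domain.isOpen
    ((D.contDiffOn_lift hθ.1).differentiableOn (by simp)) hclosed
  have hfd : ∀ z ∈ D.domain, DifferentiableAt ℝ f z := fun z hz =>
    (hf1.contDiffAt (D.domain.isOpen.mem_nhds hz)).differentiableAt one_ne_zero
  -- The pull-back of `θ` is invariant, so `f ∘ γ - f` has zero derivative on a connected set.
  have hconst : ∀ u ∈ D.U, ∀ a : 𝓞 K, ∀ x ∈ D.domain, ∀ y ∈ D.domain,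
      f (D.affine u a x) - f x = f (D.affine u a y) - f y := by
    intro u hu a x hx y hy
    have hder : ∀ z ∈ D.domain, HasFDerivAt (fun z => f (D.affine u a z) - f z)
        (0 : (InfinitePlace K → ℂ) →L[ℝ] ℝ) z := by
      intro z hz
      have h1 := ((hfd _ (D.affine_mem hu a hz)).hasFDerivAt.comp z
        (D.hasFDerivAt_affine u a z)).sub (hfd z hz).hasFDerivAt
      convert! h1 using 1
      ext1 v
      have e1 : D.scale u ∘ ![v] = ![D.scale u v] := by ext i; fin_cases i; rfl
      simp only [zero_apply, sub_apply,
        ContinuousLinearMap.comp_apply]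
      rw [hf _ (D.affine_mem hu a hz), hf z hz, ← D.affine_lift_eq θ hu a hz,
        ContinuousAlternatingMap.compContinuousLinearMap_apply, e1, sub_self]
    exact D.domain.isOpen.is_const_of_fderiv_eq_zero (𝕜 := ℝ) D.convex_domain.isPreconnected
      (fun z hz => (hder z hz).differentiableAt.differentiableWithinAt)
      (fun z hz => (hder z hz).fderiv) hx hy
  obtain ⟨⟨z₀, h₀⟩⟩ := D.domain_nonempty
  have htr : ∀ a : 𝓞 K, D.affine 1 a z₀ ∈ D.domain := fun a => D.affine_mem D.U.one_mem a h₀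
  let c : 𝓞 K →+ ℝ := AddMonoidHom.mk' (fun a => f (D.affine 1 a z₀) - f z₀) fun a b => by
    have h1 := hconst 1 D.U.one_mem b _ (htr a) _ h₀
    rw [affine_affine] at h1
    simp only [mul_one, Units.val_one, one_mul] at h1
    linarith
  have hc : c = 0 := by
    -- Evaluate `f` along both sides of `(0, u)(a, 1) = (ua, 1)(0, u)`: the contribution of `u`
    -- cancels.
    refine D.eq_zero_of_forall_map_mul c fun u hu a => ?_
    have h1 := hconst u hu 0 _ (htr a) _ h₀
    have h2 := hconst 1 D.U.one_mem (u * a) _ (D.affine_mem hu 0 h₀) _ h₀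
    rw [affine_affine] at h1 h2
    simp only [mul_one, Units.val_one, one_mul, add_zero, mul_zero, zero_add] at h1 h2
    change f _ - f _ = f _ - f _
    linarith
  refine ⟨f, hf1, hf, fun a z hz => ?_⟩
  have h1 := hconst 1 D.U.one_mem a z hz z₀ h₀
  have h2 : f (D.affine 1 a z₀) - f z₀ = 0 := DFunLike.congr_fun hc a
  linarith

/-- The fundamental form of a Hermitian metric on `X(K, U)` is not `d_θ`-exact. -/
lemma not_isTwistedExact {θ : DForm (InfinitePlace K → ℂ) D.Manifold 1} (hθ : θ.IsClosedForm)
    {Ω : DForm (InfinitePlace K → ℂ) D.Manifold 2} (hΩs : Ω.IsSmooth)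
    {g : RiemMetric (InfinitePlace K → ℂ) D.Manifold} (hg : g.IsHermitian)
    (hΩ : g.IsFundamentalForm Ω) : ¬ DForm.IsTwistedExact θ Ω := by
  classical
  rintro ⟨η, hη, rfl⟩
  obtain ⟨f, hf1, hfθ, hfper⟩ := D.exists_primitive_lift hθ
  obtain ⟨w₀, hw₀⟩ : ∃ w : InfinitePlace K, w.IsComplex := by
    have := D.complex_pos
    rw [InfinitePlace.nrComplexPlaces, Fintype.card_pos_iff] at this
    exact ⟨this.some.1, this.some.2⟩
  -- The complex line spanned by `v` moves only a coordinate at a complex place, so its translates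
  -- through the slice stay in it.
  let v : InfinitePlace K → ℂ := Pi.single w₀ 1
  have hv : v ≠ 0 := by simp [v]
  let G (y z : InfinitePlace K → ℂ) : ℝ := Real.exp (-f z) * D.lift η z ![y]
  have hG : ∀ y, ContDiffOn ℝ 1 (G y) D.domain := fun y =>
    hf1.neg.exp.mul ((ContinuousAlternatingMap.apply ℝ (InfinitePlace K → ℂ) ℝ
      ![y]).contDiff.comp_contDiffOn ((D.contDiffOn_lift hη).of_le (by simp)))
  have hGper : ∀ y, ∀ (a : 𝓞 K), ∀ z ∈ D.domain, G y (D.affine 1 a z) = G y z :=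
    fun y a z hz => by simp only [G, hfper a z hz, D.lift_add_translation η a hz]
  let Φ (z : InfinitePlace K → ℂ) : ℝ :=
    Real.exp (-f z) * D.lift (DForm.dTwisted θ η) z ![v, Complex.I • v]
  -- This is `d(e^{-f} η) = e^{-f} (dη - θ ∧ η)`, evaluated on `v` and `iv`.
  have hcurl : ∀ z ∈ D.domain,
      fderiv ℝ (G (Complex.I • v)) z v - fderiv ℝ (G v) z (Complex.I • v) = Φ z := by
    intro z hz
    have hfd := (hf1.contDiffAt (D.domain.isOpen.mem_nhds hz)).differentiableAt one_ne_zero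
    have hηd := D.differentiableAt_lift hη hz
    have h1 : ∀ x y, fderiv ℝ (G y) z x = Real.exp (-f z) *
        (fderiv ℝ (fun z => D.lift η z ![y]) z x - D.lift θ z ![x] * D.lift η z ![y]) := by
      intro x y
      have hηy : DifferentiableAt ℝ (fun z => D.lift η z ![y]) z :=
        (ContinuousAlternatingMap.apply ℝ (InfinitePlace K → ℂ) ℝ
          ![y]).differentiableAt.comp z hηd
      have h2 : HasFDerivAt (G y) _ z := hfd.hasFDerivAt.neg.exp.mul hηy.hasFDerivAt
      rw [h2.fderiv]
      simp [hfθ z hz]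
      ring
    rw [h1, h1]
    simp only [Φ]
    rw [D.lift_dTwisted_apply θ hη hz, extDeriv_one_form_apply hηd]
    ring
  have hΦpos : ∀ z ∈ D.domain, 0 < Φ z := fun z hz =>
    mul_pos (Real.exp_pos _) (D.lift_pos hg hΩ hz hv)
  have hΦc : ContinuousOn Φ D.domain :=
    hf1.continuousOn.neg.rexp.mul ((ContinuousAlternatingMap.apply ℝ (InfinitePlace K → ℂ) ℝ
      ![v, Complex.I • v]).continuous.comp_continuousOn (D.contDiffOn_lift hΩs).continuousOn)
  have hΦper : ∀ (a : 𝓞 K), ∀ z ∈ D.domain, Φ (D.affine 1 a z) = Φ z :=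
    fun a z hz => by simp only [Φ, hfper a z hz, D.lift_add_translation _ a hz]
  obtain ⟨B₁, hB₁⟩ := D.exists_bound_of_periodic (hG v).continuousOn (hGper v)
  obtain ⟨B₂, hB₂⟩ := D.exists_bound_of_periodic (hG (Complex.I • v)).continuousOn (hGper _)
  -- An upper bound for `1 / Φ` is a positive lower bound for `Φ`.
  obtain ⟨B₃, hB₃⟩ := D.exists_bound_of_periodic (Φ := fun z => (Φ z)⁻¹)
    (hΦc.inv₀ fun z hz => (hΦpos z hz).ne') fun a z hz => by rw [hΦper a z hz]
  let L : ℝ × ℝ →L[ℝ] (InfinitePlace K → ℂ) :=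
    (ContinuousLinearMap.fst ℝ ℝ ℝ).smulRight v +
      (ContinuousLinearMap.snd ℝ ℝ ℝ).smulRight (Complex.I • v)
  let ι (p : ℝ × ℝ) : InfinitePlace K → ℂ := L p + fun _ => Complex.I
  have hι1 : ∀ p, ∀ w : InfinitePlace K, w.IsReal → (ι p w).im = 1 := by
    intro p w hw
    have : w ≠ w₀ := by
      rintro rfl
      exact (InfinitePlace.not_isReal_iff_isComplex.mpr hw₀) hw
    simp [ι, L, v, this]
  have hιd : ∀ p, ι p ∈ D.domain := fun p w hw => by rw [hι1 p w hw]; exact one_pos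
  have hι : ∀ p, HasFDerivAt ι L p := fun p => L.hasFDerivAt.add_const _
  have hιG : ∀ y, ContDiff ℝ 1 (G y ∘ ι) := fun y => by
    rw [← contDiffOn_univ]
    exact (hG y).comp ((L.contDiff.add contDiff_const).contDiffOn) fun p _ => hιd p
  have hder : ∀ y p x, fderiv ℝ (G y ∘ ι) p x = fderiv ℝ (G y) (ι p) (L x) := by
    intro y p x
    have h1 := ((hG y).contDiffAt (D.domain.isOpen.mem_nhds (hιd p))).differentiableAt one_ne_zero
    rw [(h1.hasFDerivAt.comp p (hι p)).fderiv]
    rfl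
  have hB₃pos : 0 < B₃ :=
    (abs_pos.mpr (inv_ne_zero (hΦpos _ (hιd 0)).ne')).trans_le (hB₃ _ (hι1 0))
  refine not_le_curl_of_bounded (hιG (Complex.I • v)) (hιG v) (B := max B₁ B₂) (ε := B₃⁻¹)
    (fun p => (hB₂ _ (hι1 p)).trans (le_max_right _ _))
    (fun p => (hB₁ _ (hι1 p)).trans (le_max_left _ _)) (inv_pos.mpr hB₃pos) fun p => ?_
  have e1 : L (1, 0) = v := by simp [L]
  have e2 : L (0, 1) = Complex.I • v := by simp [L]
  rw [hder, hder, e1, e2, hcurl _ (hιd p)]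
  have h1 := (le_abs_self _).trans (hB₃ _ (hι1 p))
  exact inv_le_of_inv_le₀ (hΦpos _ (hιd p)) h1

end OTData

end

theorem mainTheorem10 {K : Type*} [Field K] [NumberField K] (D : OTData K)
    (θ : DForm (NumberField.InfinitePlace K → ℂ) D.Manifold 1) (hθ : θ.IsClosedForm) :
    ¬ ∃ Ω : DForm (NumberField.InfinitePlace K → ℂ) D.Manifold 2,
      Ω.IsLCK ∧ DForm.IsTwistedExact θ Ω := by
  rintro ⟨Ω, ⟨hΩs, ⟨g, hg, hΩ⟩, -⟩, hex⟩
  exact D.not_isTwistedExact hθ hΩs hg hΩ hex
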